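/- Let $k$ be an algebraically closed field of arbitrary characteristic and let $f\in k[[X,Y]]$ be an irreducible formal power series. For $g\in k[[X,Y]]$ let $\operatorname{I}(f,g)=\dim_k k[[X,Y]]/\langle f,g\rangle$ be the intersection multiplicity, and let $$S(f)=\{\operatorname{I}(f,g) : g\in k[[X,Y]],\ \operatorname{I}(f,g)<\infty\}\subset\mathbb N$$ be the semigroup of values of the plane branch defined by $f$. Then $S(f)$ has a conductor $c(f)$, that is, there is a smallest $\alpha\in S(f)$ such that $\alpha+\mathbb N\subset S(f)$, denoted $c(f)$; and the set $$S(f)\setminus\bigl(S(f)+c(f)-1\bigr)$$ has exactly $c(f)$ elements, where $S(f)+c(f)-1=\{s+c(f)-1 : s\in S(f)\}\subset\mathbb Z$. -/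

import Mathlib

namespace PlaneBranch

/-- The intersection multiplicity `I(f, g) = dim_k k[[X, Y]] / ⟨f, g⟩`, equal to `⊤` when this
dimension is infinite. The ring `k[[X, Y]]` is `MvPowerSeries (Fin 2) k`. -/
noncomputable def intersectionMultiplicity {k : Type*} [Field k]
    (f g : MvPowerSeries (Fin 2) k) : ℕ∞ :=
  Cardinal.toENat (Module.rank k (MvPowerSeries (Fin 2) k ⧸ Ideal.span {f, g}))

/-- The semigroup of values `S(f)`: the set of all finite intersection multiplicities `I(f, g)`,
`g ∈ k[[X, Y]]`. (Units `g` give the value `0`.) -/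
def valueSemigroup {k : Type*} [Field k] (f : MvPowerSeries (Fin 2) k) : Set ℕ :=
  {n : ℕ | ∃ g : MvPowerSeries (Fin 2) k, intersectionMultiplicity f g = (n : ℕ∞)}

/-- The elements `α ∈ S(f)` such that `α + ℕ ⊆ S(f)`. -/
def conductorSet {k : Type*} [Field k] (f : MvPowerSeries (Fin 2) k) : Set ℕ :=
  {α : ℕ | α ∈ valueSemigroup f ∧ ∀ n : ℕ, α + n ∈ valueSemigroup f}

/-- The conductor `c(f)`: the smallest `α ∈ S(f)` such that `α + ℕ ⊆ S(f)`
(with the default value `0` if there is no such `α`). -/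
noncomputable def conductor {k : Type*} [Field k] (f : MvPowerSeries (Fin 2) k) : ℕ :=
  sInf (conductorSet f)

end PlaneBranch

/-!
Write `R = k⟦X⟧`, with fraction field `F`.

For any `S ⊆ ℕ` which contains `0` and has a conductor `c`, the set `S \ (S + c - 1)` has `c`
elements: when `c > 0`, every element of `S + c - 1` except `c - 1` itself lies in `S`, because it
is at least `c`, and comparing the sizes of `S` and of its translate below `2c` gives the count
(`encard_sdiff_translate_conductor`). No symmetry of the semigroup is involved. The substance is
therefore that the semigroup of values `S(f)` contains all large integers.

After exchanging the variables if necessary, the Weierstrass preparation theorem shows that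
`A = k⟦X, Y⟧ / (f)` is a domain which is finite and free over `R`
(`exists_finite_free_algebra_order_norm`), and the Smith normal form of multiplication by `a` gives
`dim_k A / (a) = ord N_{A/R}(a)` (`toENat_rank_quotient_span_singleton_eq_order_norm`). Intersection
multiplicity with `f` is thus additive, and all large integers are values as soon as two consecutive
ones are.

To find two consecutive values, let `K = Frac A` and let `B` be the integral closure of `R` in `K`.
Weierstrass preparation over the complete ring `R` implies that an element of `K` whose norm lies in
`R` is integral (`isIntegral_of_isIntegral_norm`), so that `x ∈ B` or `x⁻¹ ∈ B` for each `x ∈ K`.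
An element `π` of `B` whose norm has the least positive order generates the ideal of nonunits
(`exists_uniformizer`), and since `k` is algebraically closed each element of `B` is congruent to a
constant modulo `π`. If `X = π ^ e * unit`, the completeness of `R` shows that
`1, π, …, π ^ (e - 1)` generate `B` over `R`
(`exists_eq_sum_mul_uniformizer_pow`), whence `[K : F] ≤ e`. But `[K : F] = ord N(X) = e * ord N(π)`,
so `ord N(π) = 1` (`exists_order_integralNorm_eq_one`). Writing `π` as a quotient of two elements of
`A` gives two elements of `A` with consecutive norm orders. This argument does not need `K` to be
separable over `F`, so the characteristic plays no role.
-/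

section

universe u

open PowerSeries

/-! ### Counting the difference of a semigroup and its translate -/

theorem encard_sdiff_translate_conductor {S : Set ℕ} (h0 : 0 ∈ S) {c : ℕ}
    (hc : IsLeast {α : ℕ | α ∈ S ∧ ∀ n : ℕ, α + n ∈ S} c) :
    Set.encard (((fun s : ℕ => (s : ℤ)) '' S) \ ((fun s : ℕ => (s : ℤ) + (c : ℤ) - 1) '' S)) =
      (c : ℕ∞) := by
  classical
  have hS : ∀ m, c ≤ m → m ∈ S := fun m hm => by
    obtain ⟨n, rfl⟩ := Nat.exists_eq_add_of_le hm
    exact hc.1.2 n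
  rcases Nat.eq_zero_or_pos c with rfl | hpos
  · have : ((fun s : ℕ => (s : ℤ)) '' S) \ ((fun s : ℕ => (s : ℤ) + ((0 : ℕ) : ℤ) - 1) '' S) = ∅ := by
      rw [Set.sdiff_eq_empty]
      rintro _ ⟨s, -, rfl⟩
      exact ⟨s + 1, hS _ (Nat.zero_le _), by push_cast; ring⟩
    rw [this]; simp
  -- `c - 1` is the only element of the translate that is not in `S`; it comes from `0 ∈ S`.
  have hlast : c - 1 ∉ S := fun h => by
    have : c ≤ c - 1 := hc.2 ⟨h, fun n => by
      rcases Nat.eq_zero_or_pos n with rfl | hn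
      · simpa using h
      · exact hS _ (by omega)⟩
    omega
  -- From `2 * c` on both sets contain everything; below it, `A` is `S` and `T` is the translate
  -- without `c - 1`.
  set L : Finset ℕ := (Finset.range c).filter (· ∈ S) with hL
  set A : Finset ℕ := L ∪ Finset.Ico c (2 * c) with hA
  set T : Finset ℕ := ((insert c L).erase 0).image (· + (c - 1)) with hT
  have hLc : c ∉ L := by simp [hL]
  have h0L : 0 ∈ L := by simp [hL, h0, hpos]
  have hTA : T ⊆ A := by
    intro x hx
    simp only [hT, hA, hL, Finset.mem_image, Finset.mem_erase, Finset.mem_insert,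
      Finset.mem_filter, Finset.mem_range, Finset.mem_union, Finset.mem_Ico] at hx ⊢
    omega
  have hTcard : T.card = L.card := by
    rw [hT, Finset.card_image_of_injective _ (add_left_injective _),
      Finset.card_erase_of_mem (Finset.mem_insert_of_mem h0L), Finset.card_insert_of_notMem hLc]
    simp
  have hAcard : A.card = L.card + c := by
    rw [hA, Finset.card_union_of_disjoint, Nat.card_Ico]
    · omega
    · rw [Finset.disjoint_left]
      intro x hx
      simp only [hL, Finset.mem_filter, Finset.mem_range, Finset.mem_Ico] at hx ⊢
      omega
  have hset : ((fun s : ℕ => (s : ℤ)) '' S) \ ((fun s : ℕ => (s : ℤ) + (c : ℤ) - 1) '' S) =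
      (fun s : ℕ => (s : ℤ)) '' ((A \ T : Finset ℕ) : Set ℕ) := by
    ext z
    simp only [Set.mem_sdiff, Set.mem_image, hA, hT, hL, Finset.coe_sdiff, Finset.mem_coe,
      Finset.mem_union, Finset.mem_filter, Finset.mem_range, Finset.mem_Ico, Finset.mem_image,
      Finset.mem_erase, Finset.mem_insert, not_exists, not_and]
    constructor
    · rintro ⟨⟨s, hs, rfl⟩, h⟩
      refine ⟨s, ⟨?_, ?_⟩, rfl⟩
      · by_cases hsc : s < c
        · exact Or.inl ⟨hsc, hs⟩
        · refine Or.inr ⟨by omega, ?_⟩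
          by_contra h2
          exact h (s - (c - 1)) (hS _ (by omega)) (by omega)
      · intro t ht hts
        exact h t (by rcases ht.2 with rfl | h'; exacts [hS _ le_rfl, h'.2]) (by omega)
    · rintro ⟨s, ⟨h1, h2⟩, rfl⟩
      refine ⟨⟨s, h1.elim (·.2) fun h => hS _ h.1, rfl⟩, fun t ht hts => ?_⟩
      have hne : t ≠ 0 := by
        rintro rfl
        have : s = c - 1 := by omega
        exact hlast (this ▸ h1.elim (·.2) fun h => hS _ h.1)
      refine h2 t ⟨hne, ?_⟩ (by omega)
      by_cases htc : t < c
      · exact Or.inr ⟨htc, ht⟩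
      · exact Or.inl (by omega)
  rw [hset, Function.Injective.encard_image Nat.cast_injective, Set.encard_coe_eq_coe_finsetCard,
    Finset.card_sdiff_of_subset hTA, hTcard, hAcard]
  simp

variable {k : Type*} [Field k]

/-! ### Dimensions of quotients and orders of norms -/

theorem PowerSeries.finite_and_finrank_quotient_span_singleton {a : k⟦X⟧} (ha : a ≠ 0) :
    Module.Finite k (k⟦X⟧ ⧸ Ideal.span {a}) ∧
      (Module.finrank k (k⟦X⟧ ⧸ Ideal.span {a}) : ℕ∞) = a.order := by
  have H : a.IsWeierstrassFactorizationAt (Polynomial.X ^ a.order.toNat) (divXPowOrder a) ⊥ :=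
    { isDistinguishedAt :=
        { mem := fun {n} hn => by
            have : n ≠ a.order.toNat := by simpa using hn.ne
            simp [Polynomial.coeff_X_pow, this]
          monic := Polynomial.monic_X_pow _ }
      isUnit := isUnit_divided_by_X_pow_order ha
      eq_mul := by simpa using (X_pow_order_mul_divXPowOrder (f := a)).symm }
  have hfin : Module.Finite k
      (Polynomial k ⧸ Ideal.span {(Polynomial.X ^ a.order.toNat : Polynomial k)}) :=
    (Polynomial.monic_X_pow a.order.toNat).finite_quotient
  refine ⟨Module.Finite.equiv H.algEquivQuotient.toLinearEquiv, ?_⟩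
  rw [← H.algEquivQuotient.toLinearEquiv.finrank_eq, finrank_quotient_span_eq_natDegree,
    Polynomial.natDegree_X_pow, ENat.natCast_toNat (order_finite_iff_ne_zero.2 ha).ne]

theorem PowerSeries.order_eq_of_associated {a b : k⟦X⟧} (h : Associated a b) :
    a.order = b.order := by
  obtain ⟨u, rfl⟩ := h
  rw [order_mul, order_zero_of_unit u.isUnit, add_zero]

theorem PowerSeries.isUnit_iff_order_eq_zero {a : k⟦X⟧} : IsUnit a ↔ a.order = 0 := by
  refine ⟨order_zero_of_unit, fun h => ?_⟩
  rw [isUnit_iff_constantCoeff, isUnit_iff_ne_zero]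
  intro h0
  exact (order_ne_zero_iff_constCoeff_eq_zero.2 h0) h

/-- The dimension of `A / (a)` is the order of the norm of `a`, by the Smith normal form of
multiplication by `a`. -/
theorem toENat_rank_quotient_span_singleton_eq_order_norm {A : Type*} [CommRing A] [IsDomain A]
    [Algebra k⟦X⟧ A] [Algebra k A] [IsScalarTower k k⟦X⟧ A] [Module.Finite k⟦X⟧ A]
    [Module.Free k⟦X⟧ A] {a : A} (ha : a ≠ 0) :
    Cardinal.toENat (Module.rank k (A ⧸ Ideal.span {a})) = (Algebra.norm k⟦X⟧ a).order := by
  classical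
  let b := Module.Free.chooseBasis k⟦X⟧ A
  have h := Ideal.span_singleton_eq_bot.not.2 ha
  have hs := fun i => PowerSeries.finite_and_finrank_quotient_span_singleton
    (Ideal.smithCoeffs_ne_zero b _ h i)
  have hf := fun i => (hs i).1
  let e := Ideal.quotientEquivDirectSum k b h
  have hfin : Module.Finite k (A ⧸ Ideal.span {a}) := Module.Finite.equiv e.symm
  rw [← Module.finrank_eq_rank, Cardinal.toENat_nat, Ideal.finrank_quotient_eq_sum k h b,
    PowerSeries.order_eq_of_associated (associated_norm_prod_smith b ha), order_prod]
  push_cast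
  exact Finset.sum_congr rfl fun i _ => (hs i).2

/-! ### Integrality from the constant coefficient, by Weierstrass preparation -/

instance PowerSeries.isAdicComplete_maximalIdeal :
    IsAdicComplete (IsLocalRing.maximalIdeal k⟦X⟧) k⟦X⟧ := by
  rw [maximalIdeal_eq_span_X]; infer_instance

open Polynomial in
/-- Divisibility by a distinguished polynomial in `R⟦X⟧` descends to `R[X]`, because
`R[X] / (g) → R⟦X⟧ / (g)` is injective. -/
theorem Polynomial.IsDistinguishedAt.dvd_of_coe_dvd {R : Type*} [CommRing R] {I : Ideal R}
    [IsAdicComplete I R] {g p : R[X]} (hg : g.IsDistinguishedAt I)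
    (h : (g : R⟦X⟧) ∣ (p : R⟦X⟧)) : g ∣ p := by
  rw [← Ideal.mem_span_singleton, ← Ideal.Quotient.eq_zero_iff_mem,
    ← EmbeddingLike.map_eq_zero_iff (f := hg.algEquivQuotient)]
  have : hg.algEquivQuotient (Ideal.Quotient.mk _ p) = Ideal.Quotient.mk _ (p : R⟦X⟧) := rfl
  rw [this, Ideal.Quotient.eq_zero_iff_mem, Ideal.mem_span_singleton]
  exact h

open Polynomial in
/-- A polynomial over a complete local ring which is nonzero modulo the maximal ideal, but whose
constant and leading coefficients both vanish there, has a monic factor of intermediate degree: the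
distinguished polynomial of its Weierstrass factorization, whose degree is the order of vanishing of
the reduction. -/
theorem Polynomial.exists_monic_dvd_natDegree_lt {R : Type*} [CommRing R] [IsLocalRing R]
    [IsAdicComplete (IsLocalRing.maximalIdeal R) R] {q : R[X]}
    (h0 : q.coeff 0 ∈ IsLocalRing.maximalIdeal R)
    (hlead : q.leadingCoeff ∈ IsLocalRing.maximalIdeal R)
    (hq : q.map (IsLocalRing.residue R) ≠ 0) :
    ∃ g : R[X], g.Monic ∧ g ∣ q ∧ 0 < g.natDegree ∧ g.natDegree < q.natDegree := by
  have hq' : (q : R⟦X⟧).map (IsLocalRing.residue R) ≠ 0 := by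
    rw [← Polynomial.polynomial_map_coe]; exact_mod_cast hq
  obtain ⟨g, u, H⟩ := exists_isWeierstrassFactorization hq'
  have hdeg := H.natDegree_eq_toNat_order_map
  have hcoeff : IsLocalRing.residue R (q.coeff g.natDegree) ≠ 0 := by
    have := coeff_order (φ := (q : R⟦X⟧).map (IsLocalRing.residue R)) hq'
    rw [← hdeg] at this
    simpa using this
  have key : ∀ i, i = g.natDegree → q.coeff i ∉ IsLocalRing.maximalIdeal R := by
    rintro i rfl h
    exact hcoeff ((IsLocalRing.residue_eq_zero_iff _).2 h)
  refine ⟨g, H.isDistinguishedAt.monic,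
    H.isDistinguishedAt.dvd_of_coe_dvd ⟨u, H.eq_mul⟩, ?_, ?_⟩
  · exact Nat.pos_of_ne_zero fun h => key 0 h.symm h0
  · refine lt_of_le_of_ne (Polynomial.le_natDegree_of_ne_zero fun h => hcoeff (by simp [h])) ?_
    exact fun h => key _ h.symm hlead

open Polynomial in
/-- A form of Hensel's lemma: an irreducible monic polynomial over `Frac k⟦X⟧` with integral constant
coefficient has integral coefficients. Otherwise its primitive multiple `X ^ m * p`, with `m > 0`,
has a monic factor of intermediate degree. -/
theorem mem_lifts_of_irreducible_of_coeff_zero {F : Type*} [Field F] [Algebra k⟦X⟧ F]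
    [IsFractionRing k⟦X⟧ F] {p : F[X]} (hm : p.Monic) (hp : Irreducible p)
    (h0 : p.coeff 0 ∈ (algebraMap k⟦X⟧ F).range) : p ∈ Polynomial.lifts (algebraMap k⟦X⟧ F) := by
  have hinj := IsFractionRing.injective k⟦X⟧ F
  set ϖ : F := algebraMap k⟦X⟧ F PowerSeries.X with hϖ
  have hϖ0 : ϖ ≠ 0 := by
    rw [hϖ, Ne, map_eq_zero_iff _ hinj]; exact PowerSeries.X_ne_zero
  have hex : ∃ m : ℕ, ∃ q : k⟦X⟧[X], q.map (algebraMap k⟦X⟧ F) = Polynomial.C (ϖ ^ m) * p := by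
    obtain ⟨b, hb, hb'⟩ := IsLocalization.integerNormalization_spec (nonZeroDivisors k⟦X⟧) p
    have hb0 : b ≠ 0 := nonZeroDivisors.ne_zero hb
    refine ⟨b.order.toNat, Polynomial.C ((Unit_of_divided_by_X_pow_order b)⁻¹ : k⟦X⟧ˣ).val *
      IsLocalization.integerNormalization (nonZeroDivisors k⟦X⟧) p, ?_⟩
    have hbu : ((Unit_of_divided_by_X_pow_order b)⁻¹ : k⟦X⟧ˣ).val * b =
        PowerSeries.X ^ b.order.toNat := by
      rw [Units.inv_mul_eq_iff_eq_mul, Unit_of_divided_by_X_pow_order_nonzero hb0, mul_comm,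
        X_pow_order_mul_divXPowOrder]
    rw [Polynomial.map_mul, hb', Polynomial.map_C, ← algebraMap_smul F b p, Polynomial.smul_eq_C_mul,
      ← mul_assoc, ← Polynomial.C_mul, ← map_mul, hbu, map_pow]
  classical
  obtain ⟨m, ⟨q, hq⟩, hmin⟩ : ∃ m, (∃ q : k⟦X⟧[X], q.map (algebraMap k⟦X⟧ F) =
      Polynomial.C (ϖ ^ m) * p) ∧ ∀ m' < m, ¬∃ q : k⟦X⟧[X], q.map (algebraMap k⟦X⟧ F) =
      Polynomial.C (ϖ ^ m') * p := ⟨Nat.find hex, Nat.find_spec hex, fun _ h => Nat.find_min hex h⟩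
  rcases Nat.eq_zero_or_pos (m) with hz | hpos
  · rw [hz] at hq
    exact (Polynomial.mem_lifts _).2 ⟨q, by simpa using hq⟩
  exfalso
  have hdeg : q.natDegree = p.natDegree := by
    rw [← Polynomial.natDegree_map_eq_of_injective hinj, hq,
      Polynomial.natDegree_C_mul (pow_ne_zero _ hϖ0)]
  have hX : ∀ n a, algebraMap k⟦X⟧ F a = ϖ ^ m * algebraMap k⟦X⟧ F n →
      a ∈ IsLocalRing.maximalIdeal k⟦X⟧ := fun n a h => by
    rw [hϖ, ← map_pow, ← map_mul] at h
    rw [hinj h, maximalIdeal_eq_span_X]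
    exact Ideal.mul_mem_right _ _ (Ideal.pow_mem_of_mem _ (Ideal.mem_span_singleton_self _) _ hpos)
  obtain ⟨g, hgm, hgq, hg0, hgn⟩ := Polynomial.exists_monic_dvd_natDegree_lt (q := q) (by
      obtain ⟨n, hn⟩ := h0
      refine hX n _ ?_
      rw [← Polynomial.coeff_map, hq, Polynomial.coeff_C_mul, hn]) (by
      refine hX 1 _ ?_
      rw [Polynomial.leadingCoeff, ← Polynomial.coeff_map, hq, Polynomial.coeff_C_mul, hdeg,
        hm.coeff_natDegree, map_one]) (by
      intro hzero
      have hd : Polynomial.C PowerSeries.X ∣ q := by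
        rw [Polynomial.C_dvd_iff_dvd_coeff]
        intro i
        have := congrArg (fun r => Polynomial.coeff r i) hzero
        simp only [Polynomial.coeff_map, Polynomial.coeff_zero, IsLocalRing.residue_eq_zero_iff,
          maximalIdeal_eq_span_X, Ideal.mem_span_singleton] at this
        exact this
      obtain ⟨q', rfl⟩ := hd
      refine hmin _ (Nat.sub_lt hpos one_pos) ⟨q', ?_⟩
      have hC : Polynomial.C ϖ ≠ 0 := by simpa using hϖ0
      apply mul_left_cancel₀ hC
      rw [Polynomial.map_mul, Polynomial.map_C] at hq
      rw [hϖ, hq, ← mul_assoc, ← Polynomial.C_mul, ← hϖ, ← pow_succ',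
        Nat.sub_add_cancel (Nat.one_le_iff_ne_zero.2 hpos.ne')])
  have hgp : g.map (algebraMap k⟦X⟧ F) ∣ p := by
    have h1 := Polynomial.map_dvd (algebraMap k⟦X⟧ F) hgq
    rw [hq] at h1
    exact (IsUnit.dvd_mul_left (Polynomial.isUnit_C.2 (pow_ne_zero _ hϖ0).isUnit)).1 h1
  rcases (hp.dvd_iff.1 hgp) with h | h
  · have := Polynomial.natDegree_eq_zero_of_isUnit h
    rw [hgm.natDegree_map] at this
    omega
  · have := Polynomial.natDegree_eq_of_degree_eq (Polynomial.degree_eq_degree_of_associated h)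
    rw [hgm.natDegree_map] at this
    omega

/-! ### The integral closure of `k⟦X⟧` in a finite extension of its fraction field -/

theorem ENat.lt_add_of_ne_zero {a b : ℕ∞} (ha : a ≠ ⊤) (hb : b ≠ 0) : a < a + b := by
  simpa using (ENat.add_lt_add_iff_left ha (n := 0) (m := b)).2 (pos_iff_ne_zero.2 hb)

section
variable {F K : Type*} [Field F] [Field K] [Algebra k⟦X⟧ F] [IsFractionRing k⟦X⟧ F] [Algebra F K]
  [Algebra k⟦X⟧ K] [IsScalarTower k⟦X⟧ F K] [FiniteDimensional F K]

/-- The constant coefficient of the minimal polynomial of `x` is integral, since up to sign a power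
of it is the norm of `x`; hence the minimal polynomial itself is integral. -/
theorem isIntegral_of_isIntegral_norm {x : K} (hx : IsIntegral k⟦X⟧ (Algebra.norm F x)) :
    IsIntegral k⟦X⟧ x := by
  have hxF : IsIntegral F x := IsIntegral.of_finite F x
  have h0 : IsIntegral k⟦X⟧ ((minpoly F x).coeff 0) := by
    have hpb := Algebra.PowerBasis.norm_gen_eq_coeff_zero_minpoly
      (IntermediateField.adjoin.powerBasis hxF)
    rw [IntermediateField.adjoin.powerBasis_gen, IntermediateField.minpoly_gen] at hpb
    rw [Algebra.norm_eq_norm_adjoin, hpb] at hx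
    have h1 := hx.of_pow Module.finrank_pos
    have hneg : IsIntegral k⟦X⟧
        ((-1 : F) ^ (IntermediateField.adjoin.powerBasis hxF).dim) := isIntegral_one.neg.pow _
    have h2 := hneg.mul h1
    rwa [← mul_assoc, ← mul_pow, neg_one_mul, neg_neg, one_pow, one_mul] at h2
  obtain ⟨q, hq, -, hqm⟩ := Polynomial.lifts_and_natDegree_eq_and_monic
    (mem_lifts_of_irreducible_of_coeff_zero (minpoly.monic hxF) (minpoly.irreducible hxF)
      (IsIntegrallyClosed.isIntegral_iff.1 h0)) (minpoly.monic hxF)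
  refine ⟨q, hqm, ?_⟩
  rw [← Polynomial.aeval_def, ← Polynomial.aeval_map_algebraMap F, hq, minpoly.aeval]

theorem Algebra.norm_inv_of_ne_zero {F K : Type*} [Field F] [Field K] [Algebra F K] {x : K}
    (hx : x ≠ 0) : Algebra.norm F x⁻¹ = (Algebra.norm F x)⁻¹ :=
  eq_inv_of_mul_eq_one_right (by rw [← map_mul, mul_inv_cancel₀ hx, map_one])

variable (F) in
include F in
theorem isIntegral_or_isIntegral_inv (x : K) : IsIntegral k⟦X⟧ x ∨ IsIntegral k⟦X⟧ x⁻¹ := by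
  by_cases hx : x = 0
  · exact Or.inl (hx ▸ isIntegral_zero)
  rcases ValuationRing.isInteger_or_isInteger k⟦X⟧ (Algebra.norm F x) with ⟨a, ha⟩ | ⟨a, ha⟩
  · exact Or.inl (isIntegral_of_isIntegral_norm (ha ▸ isIntegral_algebraMap))
  · refine Or.inr (isIntegral_of_isIntegral_norm (F := F) ?_)
    rw [Algebra.norm_inv_of_ne_zero hx, ← ha]
    exact isIntegral_algebraMap

variable (F K) in
/-- The norm `b ↦ N_{K/F}(b)` of an integral element, as an element of `k⟦X⟧`. Its order plays the
role of the valuation of `K`. -/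
noncomputable abbrev integralNorm : integralClosure k⟦X⟧ K →* k⟦X⟧ :=
  Algebra.intNormAux k⟦X⟧ F K (integralClosure k⟦X⟧ K)

local notation "B" => integralClosure k⟦X⟧ K
local notation "N" => integralNorm (k := k) F K

omit [FiniteDimensional F K] in
theorem algebraMap_integralNorm (b : B) :
    algebraMap k⟦X⟧ F (N b) = Algebra.norm F (b : K) :=
  Algebra.map_intNormAux b

theorem isUnit_integralNorm_iff {b : B} : IsUnit (N b) ↔ IsUnit b := by
  refine ⟨fun h => ?_, fun h => h.map _⟩
  obtain ⟨u, hu⟩ := h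
  have hn : Algebra.norm F (b : K) * algebraMap k⟦X⟧ F (u⁻¹ : k⟦X⟧ˣ).val = 1 := by
    rw [← algebraMap_integralNorm, ← hu, ← map_mul, Units.mul_inv, map_one]
  have hb : (b : K) ≠ 0 := fun h => by simp [h] at hn
  have hi : IsIntegral k⟦X⟧ ((b : K)⁻¹) := by
    refine isIntegral_of_isIntegral_norm (F := F) ?_
    rw [Algebra.norm_inv_of_ne_zero hb, inv_eq_of_mul_eq_one_right hn]
    exact isIntegral_algebraMap
  exact IsUnit.of_mul_eq_one ⟨_, hi⟩ (Subtype.ext (mul_inv_cancel₀ hb))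

theorem integralNorm_ne_zero {b : B} (hb : b ≠ 0) : N b ≠ 0 := by
  intro h
  have := algebraMap_integralNorm (F := F) b
  rw [h, map_zero, eq_comm, Algebra.norm_eq_zero_iff] at this
  exact hb (Subtype.ext this)

theorem integralNorm_algebraMap (r : k⟦X⟧) :
    N (algebraMap k⟦X⟧ B r) = r ^ Module.finrank F K := by
  apply IsFractionRing.injective k⟦X⟧ F
  rw [algebraMap_integralNorm, map_pow, ← Algebra.norm_algebraMap, 
    ← IsScalarTower.algebraMap_apply]
  rfl

variable (F) in
include F in
theorem dvd_or_dvd_integralClosure (a b : B) : a ∣ b ∨ b ∣ a := by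
  by_cases ha : a = 0
  · exact Or.inr (ha ▸ dvd_zero b)
  by_cases hb : b = 0
  · exact Or.inl (hb ▸ dvd_zero a)
  have ha' : (a : K) ≠ 0 := fun h => ha (Subtype.ext h)
  have hb' : (b : K) ≠ 0 := fun h => hb (Subtype.ext h)
  rcases isIntegral_or_isIntegral_inv (k := k) F ((b : K) / a) with h | h
  · exact Or.inl ⟨⟨_, h⟩, Subtype.ext (mul_div_cancel₀ _ ha').symm⟩
  · rw [inv_div] at h
    exact Or.inr ⟨⟨_, h⟩, Subtype.ext (mul_div_cancel₀ _ hb').symm⟩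

variable (F) in
include F in
theorem not_isUnit_X_integralClosure : ¬ IsUnit (algebraMap k⟦X⟧ B X) := by
  rw [← isUnit_integralNorm_iff (F := F), integralNorm_algebraMap,
    isUnit_pow_iff Module.finrank_pos.ne']
  exact X_prime.not_isUnit

variable (F K) in
include F in
omit [FiniteDimensional F K] in
theorem algebraMap_X_integralClosure_ne_zero : algebraMap k⟦X⟧ B X ≠ 0 := by
  have hinj : Function.Injective (algebraMap k⟦X⟧ K) := by
    rw [IsScalarTower.algebraMap_eq k⟦X⟧ F K]
    exact (algebraMap F K).injective.comp (IsFractionRing.injective _ _)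
  exact fun h => X_ne_zero (hinj ((congrArg Subtype.val h).trans (map_zero _).symm))

variable (k F K) in
include F in
/-- The ideal of nonunits of the integral closure is principal. A generator is a nonunit whose norm
has the least possible order, since divisibility is a total preorder. -/
theorem exists_uniformizer : ∃ π : B, π ≠ 0 ∧ ¬ IsUnit π ∧ ∀ b : B, ¬ IsUnit b → π ∣ b := by
  obtain ⟨π, ⟨hπ0, hπ⟩, hmin⟩ := (InvImage.wf (fun b : B => (N b).order)
    (wellFounded_lt (α := ℕ∞))).has_min {b : B | b ≠ 0 ∧ ¬ IsUnit b}
    ⟨algebraMap k⟦X⟧ B X, algebraMap_X_integralClosure_ne_zero F K, not_isUnit_X_integralClosure F⟩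
  refine ⟨π, hπ0, hπ, fun b hb => ?_⟩
  rcases dvd_or_dvd_integralClosure F π b with h | ⟨c, rfl⟩
  · exact h
  by_cases hc : IsUnit c
  · exact (hc.dvd_mul_right.1 (dvd_refl (b * c)) : b * c ∣ b)
  · exfalso
    have hb0 : b ≠ 0 := left_ne_zero_of_mul hπ0
    have hc0 : c ≠ 0 := right_ne_zero_of_mul hπ0
    refine hmin b ⟨hb0, hb⟩ ?_
    change (N b).order < (N (b * c)).order
    rw [map_mul, order_mul]
    refine ENat.lt_add_of_ne_zero (order_finite_iff_ne_zero.2 (integralNorm_ne_zero hb0)).ne ?_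
    rwa [Ne, ← isUnit_iff_order_eq_zero, isUnit_integralNorm_iff]

variable (F) in
include F in
theorem exists_eq_uniformizer_pow_mul_unit {π : B} (hπ : ¬ IsUnit π)
    (hdvd : ∀ b : B, ¬ IsUnit b → π ∣ b) (b : B) (hb : b ≠ 0) :
    ∃ (e : ℕ) (u : B), IsUnit u ∧ b = π ^ e * u := by
  induction b using (InvImage.wf (fun b : B => (N b).order)
    (wellFounded_lt (α := ℕ∞))).induction with
  | _ b ih =>
    by_cases hu : IsUnit b
    · exact ⟨0, b, hu, by simp⟩
    obtain ⟨c, rfl⟩ := hdvd b hu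
    have hc0 : c ≠ 0 := right_ne_zero_of_mul hb
    obtain ⟨e, u, hu', rfl⟩ := ih c (by
      change (N c).order < (N (π * c)).order
      rw [map_mul, order_mul, add_comm]
      refine ENat.lt_add_of_ne_zero (order_finite_iff_ne_zero.2 (integralNorm_ne_zero hc0)).ne ?_
      rwa [Ne, ← isUnit_iff_order_eq_zero, isUnit_integralNorm_iff]) hc0
    exact ⟨e + 1, u, hu', by ring⟩

variable (F) in
include F in
/-- The residue field of the integral closure is `k`: if `p` is a monic equation of `b` and `c`
runs over the roots of `p` modulo `X`, then `X` divides the product of the `b - c`, so that these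
are not all units. -/
theorem exists_not_isUnit_sub_const [IsAlgClosed k] (b : B) :
    ∃ c : k, ¬ IsUnit (b - algebraMap k⟦X⟧ B (C c)) := by
  by_contra! hcon
  obtain ⟨p, hpm, hp⟩ := (integralClosure.isIntegral b : IsIntegral k⟦X⟧ b)
  rw [← Polynomial.aeval_def] at hp
  set q : Polynomial k := p.map constantCoeff with hq
  have hprod : (q.roots.map fun c => Polynomial.X - Polynomial.C c).prod = q :=
    ((IsAlgClosed.splits q).eq_prod_roots_of_monic (hpm.map _)).symm
  set r : Polynomial k⟦X⟧ := (q.roots.map fun c => Polynomial.X - Polynomial.C (C c)).prod with hr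
  have hrq : r.map constantCoeff = q := by
    rw [hr, Polynomial.map_multiset_prod, Multiset.map_map]
    simpa using hprod
  have hru : IsUnit (Polynomial.aeval b r) := by
    rw [hr, map_multiset_prod, Multiset.map_map]
    refine Multiset.prod_induction IsUnit _ (fun _ _ => IsUnit.mul) isUnit_one fun x hx => ?_
    obtain ⟨c, -, rfl⟩ := Multiset.mem_map.1 hx
    simpa using hcon c
  obtain ⟨s, hs⟩ : Polynomial.C X ∣ p - r := by
    rw [Polynomial.C_dvd_iff_dvd_coeff]
    intro i
    have : ((p - r).map constantCoeff).coeff i = 0 := by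
      rw [Polynomial.map_sub, hrq, sub_self, Polynomial.coeff_zero]
    rwa [Polynomial.coeff_map, ← X_dvd_iff] at this
  have hps := congrArg (Polynomial.aeval b) hs
  rw [map_sub, hp, zero_sub, map_mul, Polynomial.aeval_C] at hps
  exact not_isUnit_X_integralClosure F (isUnit_of_mul_isUnit_left (hps ▸ hru.neg))

variable (F) in
include F in
theorem eq_zero_of_forall_X_pow_dvd {b : B} (h : ∀ m : ℕ, algebraMap k⟦X⟧ B X ^ m ∣ b) : b = 0 := by
  by_contra hb
  have hfin := (order_finite_iff_ne_zero.2 (integralNorm_ne_zero (F := F) hb)).ne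
  obtain ⟨m, hm⟩ := ENat.ne_top_iff_exists.1 hfin
  obtain ⟨c, hc⟩ := h (m + 1)
  have hdvd : (X : k⟦X⟧) ^ (m + 1) ∣ N b := by
    rw [hc, ← map_pow, map_mul, integralNorm_algebraMap]
    exact Dvd.dvd.mul_right (dvd_pow_self _ Module.finrank_pos.ne') _
  have := X_pow_dvd_iff.1 hdvd
  have hle : ((m + 1 : ℕ) : ℕ∞) ≤ (N b).order := le_order _ _ fun i hi =>
    this i (by exact_mod_cast hi)
  rw [← hm] at hle
  have : m + 1 ≤ m := by exact_mod_cast hle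
  omega

variable (F) in
include F in
/-- If `X = π ^ e * unit`, then `1, π, …, π ^ (e - 1)` generate the integral closure over `k⟦X⟧`.
Expanding `b` in powers of `π` with coefficients in `k` and trading `π ^ e` for `X` gives the
coefficients of the power series `r i`. -/
theorem exists_eq_sum_mul_uniformizer_pow [IsAlgClosed k] {π : B}
    (hdvd : ∀ b : B, ¬ IsUnit b → π ∣ b) {e : ℕ} {u : B} (hu : IsUnit u)
    (hX : algebraMap k⟦X⟧ B X = π ^ e * u) (b : B) :
    ∃ r : Fin e → k⟦X⟧, b = ∑ i, algebraMap k⟦X⟧ B (r i) * π ^ (i : ℕ) := by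
  have hstep : ∀ b : B, ∃ (c : k) (b' : B), b = algebraMap k⟦X⟧ B (C c) + π * b' := fun b => by
    obtain ⟨c, hc⟩ := exists_not_isUnit_sub_const F b
    obtain ⟨b', hb'⟩ := hdvd _ hc
    exact ⟨c, b', by rw [← hb']; ring⟩
  choose cf g hg using hstep
  have hiter : ∀ (m : ℕ) (b : B), b = ∑ i ∈ Finset.range m,
      algebraMap k⟦X⟧ B (C (cf (g^[i] b))) * π ^ i + π ^ m * g^[m] b := by
    intro m
    induction m with
    | zero => intro b; simp
    | succ m ih =>
      intro b
      conv_lhs => rw [ih b, hg (g^[m] b)]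
      rw [Finset.sum_range_succ, Function.iterate_succ_apply']
      ring
  obtain ⟨v, rfl⟩ := hu
  -- `h` is the remainder of `b` after its first `e` terms, divided by `X`.
  set h : B → B := fun b => (v⁻¹ : Bˣ).val * g^[e] b with hh
  have hhb : ∀ b : B, b = ∑ i : Fin e, algebraMap k⟦X⟧ B (C (cf (g^[i] b))) * π ^ (i : ℕ) +
      algebraMap k⟦X⟧ B X * h b := by
    intro b
    conv_lhs => rw [hiter e b]
    rw [Finset.sum_range, hX, hh]
    simp only [mul_assoc, Units.mul_inv_cancel_left]
  set r : B → Fin e → k⟦X⟧ := fun b i => mk fun m => cf (g^[i] (h^[m] b)) with hr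
  have hrb : ∀ b i, r b i = C (cf (g^[i] b)) + X * r (h b) i := by
    intro b i
    rw [eq_X_mul_shift_add_const (r b i), add_comm]
    simp [hr]
  -- The error `D b` satisfies `D b = X * D (h b)`, so it is divisible by every power of `X`.
  set D : B → B := fun b => b - ∑ i, algebraMap k⟦X⟧ B (r b i) * π ^ (i : ℕ) with hD
  have hDb : ∀ b, D b = algebraMap k⟦X⟧ B X * D (h b) := by
    intro b
    have h1 : ∑ i, algebraMap k⟦X⟧ B (r b i) * π ^ (i : ℕ) =
        ∑ i : Fin e, algebraMap k⟦X⟧ B (C (cf (g^[i] b))) * π ^ (i : ℕ) +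
        algebraMap k⟦X⟧ B X * ∑ i, algebraMap k⟦X⟧ B (r (h b) i) * π ^ (i : ℕ) := by
      rw [Finset.mul_sum, ← Finset.sum_add_distrib]
      refine Finset.sum_congr rfl fun i _ => ?_
      rw [hrb b i, map_add, map_mul]
      ring
    simp only [hD]
    rw [h1]
    linear_combination hhb b
  have hpow : ∀ (m : ℕ) (b : B), algebraMap k⟦X⟧ B X ^ m ∣ D b := by
    intro m
    induction m with
    | zero => intro b; simp
    | succ m ih =>
      intro b
      rw [hDb b, pow_succ']
      exact mul_dvd_mul_left _ (ih _)
  exact ⟨r b, sub_eq_zero.1 (eq_zero_of_forall_X_pow_dvd F fun m => hpow m b)⟩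

variable (k F K) in
/-- The order of the norm takes the value `1` on the integral closure: with `X = π ^ e * unit`, we
have `[K : F] = ord N(X) = e * ord N(π)`, while the powers of `π` show that `[K : F] ≤ e`. -/
theorem exists_order_integralNorm_eq_one [IsAlgClosed k] : ∃ b : B, (N b).order = 1 := by
  obtain ⟨π, hπ0, hπ, hdvd⟩ := exists_uniformizer k F K
  obtain ⟨e, u, hu, hX⟩ := exists_eq_uniformizer_pow_mul_unit F hπ hdvd _
    (algebraMap_X_integralClosure_ne_zero F K)
  have hle : Module.finrank F K ≤ e := by
    have hspan : Submodule.span F (Set.range fun i : Fin e => (π : K) ^ (i : ℕ)) = ⊤ := by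
      rw [eq_top_iff]
      rintro x -
      obtain ⟨y, hy, hxy⟩ := ((IsFractionRing.isAlgebraic_iff k⟦X⟧ F K).2
        (Algebra.IsAlgebraic.isAlgebraic x)).exists_integral_multiple
      have hy' : algebraMap k⟦X⟧ F y ≠ 0 := fun h =>
        hy (IsFractionRing.injective k⟦X⟧ F (h.trans (map_zero _).symm))
      obtain ⟨r, hr⟩ := exists_eq_sum_mul_uniformizer_pow F hdvd hu hX ⟨_, hxy⟩
      have hr' : algebraMap k⟦X⟧ F y • x = ∑ i, algebraMap k⟦X⟧ F (r i) • (π : K) ^ (i : ℕ) := by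
        have h : y • x = ∑ i, algebraMap k⟦X⟧ K (r i) * (π : K) ^ (i : ℕ) := by
          have h := congrArg (algebraMap B K) hr
          simp only [map_sum, map_mul, map_pow, ← IsScalarTower.algebraMap_apply k⟦X⟧ B K] at h
          exact h
        simpa only [algebraMap_smul, ← Algebra.smul_def] using h
      rw [← inv_smul_smul₀ hy' x, hr']
      exact Submodule.smul_mem _ _ (Submodule.sum_mem _ fun i _ =>
        Submodule.smul_mem _ _ (Submodule.subset_span ⟨i, rfl⟩))
    have := finrank_range_le_card (R := F) (fun i : Fin e => (π : K) ^ (i : ℕ))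
    rw [Set.finrank, hspan, finrank_top, Fintype.card_fin] at this
    exact this
  have hord := congrArg (fun b => (N b).order) hX
  simp only [integralNorm_algebraMap, order_X, map_mul, map_pow, order_mul, order_pow,
    isUnit_iff_order_eq_zero.1 (isUnit_integralNorm_iff (F := F).2 hu), add_zero] at hord
  obtain ⟨o, ho⟩ := ENat.ne_top_iff_exists.1
    (order_finite_iff_ne_zero.2 (integralNorm_ne_zero (F := F) hπ0)).ne
  have ho0 : o ≠ 0 := by
    rintro rfl
    exact hπ (isUnit_integralNorm_iff.1 (isUnit_iff_order_eq_zero.2 ho.symm))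
  refine ⟨π, ?_⟩
  rw [← ho] at hord ⊢
  have hord' : Module.finrank F K = e * o := by
    have h : ((Module.finrank F K : ℕ) : ℕ∞) = ((e * o : ℕ) : ℕ∞) := by simpa using hord
    exact_mod_cast h
  have hpos : 0 < Module.finrank F K := Module.finrank_pos
  have : o = 1 := by
    rcases o with _ | _ | o
    · exact absurd rfl ho0
    · rfl
    · nlinarith
  rw [this]; rfl

end

/-! ### Values of a plane branch -/

/-- Every element of `Frac A`, for `A` algebraic over `R`, has a denominator in `R`. -/
theorem IsFractionRing.isLocalization_algebraMapSubmonoid (R A K : Type*) [CommRing R] [IsDomain R]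
    [CommRing A] [IsDomain A] [Field K] [Algebra R A] [FaithfulSMul R A] [Algebra.IsAlgebraic R A]
    [Algebra A K] [IsFractionRing A K] :
    IsLocalization (Algebra.algebraMapSubmonoid A (nonZeroDivisors R)) K where
  map_units := by
    rintro ⟨_, r, hr, rfl⟩
    refine IsUnit.mk0 _ fun h => nonZeroDivisors.ne_zero hr ?_
    exact FaithfulSMul.algebraMap_injective R A
      ((IsFractionRing.injective A K (h.trans (map_zero _).symm)).trans (map_zero _).symm)
  surj z := by
    obtain ⟨a, s, hs, rfl⟩ := IsFractionRing.div_surjective (A := A) z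
    obtain ⟨b, r, hr, hb⟩ := Algebra.IsAlgebraic.exists_smul_eq_mul R a
      (nonZeroDivisors.ne_zero hs)
    refine ⟨⟨b, ⟨_, r, mem_nonZeroDivisors_of_ne_zero hr, rfl⟩⟩, ?_⟩
    have hs' : algebraMap A K s ≠ 0 := fun h => nonZeroDivisors.ne_zero hs
      (IsFractionRing.injective A K (h.trans (map_zero _).symm))
    rw [div_mul_eq_mul_div, div_eq_iff hs', ← map_mul, ← map_mul, mul_comm b, ← hb,
      Algebra.smul_def, mul_comm]
  exists_of_eq h := ⟨1, by rw [IsFractionRing.injective A K h]⟩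

theorem exists_order_norm_eq_add_one [IsAlgClosed k] (A : Type*) [CommRing A] [IsDomain A]
    [Algebra k⟦X⟧ A] [Module.Finite k⟦X⟧ A] [Module.Free k⟦X⟧ A] :
    ∃ a b : A, a ≠ 0 ∧ b ≠ 0 ∧
      (Algebra.norm k⟦X⟧ a).order = (Algebra.norm k⟦X⟧ b).order + 1 := by
  let F := FractionRing k⟦X⟧
  let K := FractionRing A
  let : Algebra F K := FractionRing.liftAlgebra k⟦X⟧ K
  have : IsScalarTower k⟦X⟧ F K := FractionRing.isScalarTower_liftAlgebra k⟦X⟧ K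
  have hloc : IsLocalization (Algebra.algebraMapSubmonoid A (nonZeroDivisors k⟦X⟧)) K :=
    IsFractionRing.isLocalization_algebraMapSubmonoid _ _ _
  have : FiniteDimensional F K := .of_isLocalization k⟦X⟧ A (nonZeroDivisors k⟦X⟧)
  obtain ⟨x, hx⟩ := exists_order_integralNorm_eq_one k F K
  obtain ⟨⟨a, ⟨_, r, hr, rfl⟩⟩, hxa⟩ :=
    IsLocalization.surj (Algebra.algebraMapSubmonoid A (nonZeroDivisors k⟦X⟧)) (x : K)
  have hn : ∀ a : A, Algebra.norm F (algebraMap A K a) =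
    algebraMap k⟦X⟧ F (Algebra.norm k⟦X⟧ a) := Algebra.norm_localization k⟦X⟧ (nonZeroDivisors k⟦X⟧)
  have hb0 : algebraMap k⟦X⟧ A r ≠ 0 := fun h => nonZeroDivisors.ne_zero hr
    (FaithfulSMul.algebraMap_injective k⟦X⟧ A (h.trans (map_zero _).symm))
  have key : integralNorm F K x * Algebra.norm k⟦X⟧ (algebraMap k⟦X⟧ A r) =
      Algebra.norm k⟦X⟧ a := by
    apply IsFractionRing.injective k⟦X⟧ F
    rw [map_mul, algebraMap_integralNorm, ← hn, ← hn, ← map_mul]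
    exact congrArg _ hxa
  have hord := congrArg PowerSeries.order key
  rw [order_mul, hx, add_comm] at hord
  refine ⟨a, algebraMap k⟦X⟧ A r, ?_, hb0, hord.symm⟩
  rintro rfl
  rw [Algebra.norm_zero, order_zero] at hord
  have hfin := order_finite_iff_ne_zero.2 (Algebra.norm_ne_zero_iff (R := k⟦X⟧).2 hb0)
  exact (ENat.add_lt_top.2 ⟨hfin, ENat.one_lt_top⟩).ne hord

open PlaneBranch

theorem zero_mem_valueSemigroup (f : MvPowerSeries (Fin 2) k) : 0 ∈ valueSemigroup f := by
  refine ⟨1, ?_⟩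
  have h : Ideal.span {f, 1} = ⊤ := Ideal.eq_top_of_isUnit_mem _
    (Ideal.subset_span (Set.mem_insert_of_mem _ rfl)) isUnit_one
  rw [intersectionMultiplicity, h]
  have : Subsingleton (MvPowerSeries (Fin 2) k ⧸ (⊤ : Ideal (MvPowerSeries (Fin 2) k))) :=
    Ideal.Quotient.subsingleton_iff.2 rfl
  rw [rank_subsingleton']
  simp

/-- After a choice of the order of the variables, `f` is regular in the outer one: otherwise both
variables would divide `f`. -/
theorem exists_algEquiv_map_residue_ne_zero {f : MvPowerSeries (Fin 2) k} (hf : Irreducible f) :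
    ∃ φ : MvPowerSeries (Fin 2) k ≃ₐ[k] k⟦X⟧⟦X⟧,
      (φ f).map (IsLocalRing.residue k⟦X⟧) ≠ 0 := by
  let ψ (e : Fin 2 ≃ Option Unit) : MvPowerSeries (Fin 2) k ≃ₐ[k] k⟦X⟧⟦X⟧ :=
    (MvPowerSeries.renameEquiv k e).trans (MvPowerSeries.optionEquivLeft Unit k)
  have hψ : ∀ e i, ψ e (MvPowerSeries.X i) =
      MvPowerSeries.optionEquivLeft Unit k (MvPowerSeries.X (e i)) := fun e i => by
    simp [ψ]
  have hdvd : ∀ e i, e i = some () → (ψ e f).map (IsLocalRing.residue k⟦X⟧) = 0 →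
      MvPowerSeries.X i ∣ f := by
    intro e i hi h0
    have : ψ e (MvPowerSeries.X i) ∣ ψ e f := by
      rw [hψ, hi, MvPowerSeries.optionEquivLeft_X_some]
      have hco : ∀ n, ∃ c : k⟦X⟧, coeff n (ψ e f) = X * c := fun n => by
        have := congrArg (coeff n) h0
        rw [coeff_map, map_zero, IsLocalRing.residue_eq_zero_iff, maximalIdeal_eq_span_X,
          Ideal.mem_span_singleton] at this
        exact this
      choose c hc using hco
      refine ⟨mk c, ?_⟩
      ext1 n
      rw [hc, coeff_C_mul, coeff_mk]
      rfl
    simpa using map_dvd (ψ e).symm this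
  let e : Fin 2 ≃ Option Unit :=
    (_root_.finSuccEquiv 1).trans (Equiv.optionCongr (Equiv.equivPUnit (Fin 1)))
  by_contra! hcon
  have h0 := hdvd e (e.symm (some ())) (by simp) (hcon (ψ e))
  have h1 := hdvd (e.trans (Equiv.swap none (some ()))) (e.symm none) (by simp) (hcon (ψ _))
  obtain ⟨c, rfl⟩ := h0
  have hX : ¬ IsUnit (MvPowerSeries.X (e.symm (some ())) : MvPowerSeries (Fin 2) k) := by
    rw [MvPowerSeries.isUnit_iff_constantCoeff]; simp
  have h2 := (((of_irreducible_mul hf).resolve_left hX).dvd_mul_right).1 h1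
  rw [MvPowerSeries.X_dvd_iff] at h2
  have := h2 (Finsupp.single (e.symm (some ())) 1) (by simp)
  simp [MvPowerSeries.coeff_X] at this

/-- The isomorphism `R[X] / (p) ≃ R⟦X⟧ / (g)` attached to a Weierstrass factorization `g = p * h`,
over a base ring `S` of `R`. It is stated for an abstract `R` because for `R = k⟦X⟧` Mathlib has two
different `R`-algebra structures on `R⟦X⟧`. -/
noncomputable def PowerSeries.IsWeierstrassFactorizationAt.algEquivQuotientRestrictScalars
    (S : Type*) {R : Type*} [CommRing S] [CommRing R] [Algebra S R] {I : Ideal R}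
    [IsAdicComplete I R] {g : R⟦X⟧} {p : Polynomial R} {h : R⟦X⟧}
    (H : g.IsWeierstrassFactorizationAt p h I) :
    (Polynomial R ⧸ Ideal.span {p}) ≃ₐ[S] R⟦X⟧ ⧸ Ideal.span {g} :=
  H.algEquivQuotient.restrictScalars S

/-- The orders of the norms of nonzero elements of a suitable finite free `k⟦X⟧`-domain `A` are
intersection multiplicities with `f`. Here `A = k⟦X⟧[Y] / (p)`, with `p` the distinguished polynomial
of `f`, which is isomorphic to `k⟦X, Y⟧ / (f)`. -/
theorem exists_finite_free_algebra_order_norm {k : Type u} [Field k]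
    {f : MvPowerSeries (Fin 2) k} (hf : Irreducible f) :
    ∃ (A : Type u) (_ : CommRing A) (_ : IsDomain A) (_ : Algebra k⟦X⟧ A) (_ : Module.Finite k⟦X⟧ A)
      (_ : Module.Free k⟦X⟧ A), ∀ a : A, a ≠ 0 → ∃ g : MvPowerSeries (Fin 2) k,
        intersectionMultiplicity f g = (Algebra.norm k⟦X⟧ a).order := by
  obtain ⟨φ, hφ⟩ := exists_algEquiv_map_residue_ne_zero hf
  obtain ⟨p, u, H⟩ := exists_isWeierstrassFactorization hφ
  have hirr : Irreducible (φ f) := (MulEquiv.irreducible_iff φ).2 hf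
  have hprime : (Ideal.span {φ f}).IsPrime :=
    (Ideal.span_singleton_prime hirr.ne_zero).2 hirr.prime
  let e : (Polynomial k⟦X⟧ ⧸ Ideal.span {p}) ≃ₐ[k] (k⟦X⟧⟦X⟧ ⧸ Ideal.span {φ f}) :=
    H.algEquivQuotientRestrictScalars k
  have hfin : Module.Finite k⟦X⟧ (Polynomial k⟦X⟧ ⧸ Ideal.span {p}) :=
    H.isDistinguishedAt.monic.finite_quotient
  have hfree : Module.Free k⟦X⟧ (Polynomial k⟦X⟧ ⧸ Ideal.span {p}) :=
    H.isDistinguishedAt.monic.free_quotient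
  have hdom : IsDomain (Polynomial k⟦X⟧ ⧸ Ideal.span {p}) := e.toMulEquiv.isDomain _
  refine ⟨Polynomial k⟦X⟧ ⧸ Ideal.span {p}, inferInstance, hdom, inferInstance, hfin, hfree, ?_⟩
  intro a ha
  obtain ⟨g, hg⟩ := Ideal.Quotient.mk_surjective (e a)
  refine ⟨φ.symm g, ?_⟩
  rw [← toENat_rank_quotient_span_singleton_eq_order_norm ha, intersectionMultiplicity]
  congr 1
  have e1 : (MvPowerSeries (Fin 2) k ⧸ Ideal.span {f, φ.symm g}) ≃ₐ[k]
      (k⟦X⟧⟦X⟧ ⧸ Ideal.span {φ f} ⊔ Ideal.span {g}) := Ideal.quotientEquivAlg _ _ φ (by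
    rw [Ideal.map_span, Set.image_pair, Ideal.span_insert]
    simp)
  have e2 : ((Polynomial k⟦X⟧ ⧸ Ideal.span {p}) ⧸ Ideal.span {a}) ≃ₐ[k]
      ((k⟦X⟧⟦X⟧ ⧸ Ideal.span {φ f}) ⧸
        (Ideal.span {g}).map (Ideal.Quotient.mkₐ k (Ideal.span {φ f}))) :=
    Ideal.quotientEquivAlg _ _ e (by
      rw [Ideal.map_span, Ideal.map_span, Set.image_singleton, Set.image_singleton]
      exact congrArg (fun x => Ideal.span {x}) hg)
  have e3 := e1.trans ((DoubleQuot.quotQuotEquivQuotSupₐ k _ _).symm.trans e2.symm)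
  exact e3.toLinearEquiv.rank_eq

/-- From two consecutive values `s` and `s + 1`, sums yield every integer from `s * s` on. -/
theorem conductorSet_nonempty [IsAlgClosed k] {f : MvPowerSeries (Fin 2) k} (hf : Irreducible f) :
    (conductorSet f).Nonempty := by
  obtain ⟨A, _, _, _, _, _, hA⟩ := exists_finite_free_algebra_order_norm hf
  obtain ⟨a, b, ha, hb, hab⟩ := exists_order_norm_eq_add_one (k := k) A
  have hne : ∀ {a : A}, a ≠ 0 → Algebra.norm k⟦X⟧ a ≠ 0 := Algebra.norm_ne_zero_iff.2
  obtain ⟨s, hs⟩ := ENat.ne_top_iff_exists.1 (order_finite_iff_ne_zero.2 (hne hb)).ne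
  have hmem : ∀ i j : ℕ, i * (s + 1) + j * s ∈ valueSemigroup f := by
    intro i j
    obtain ⟨g, hg⟩ := hA (a ^ i * b ^ j) (mul_ne_zero (pow_ne_zero _ ha) (pow_ne_zero _ hb))
    refine ⟨g, ?_⟩
    rw [hg, map_mul, map_pow, map_pow, order_mul, order_pow, order_pow, hab, ← hs]
    simp only [nsmul_eq_mul]
    push_cast
    ring
  have hall : ∀ n, s * s + n ∈ valueSemigroup f := by
    intro n
    rcases Nat.eq_zero_or_pos s with rfl | hs0
    · simpa using hmem n 0
    · have h1 := Nat.div_add_mod n s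
      have h2 := (Nat.mod_lt n hs0).le
      -- Take `s + n / s` copies of `s` and replace `n % s < s` of them by `s + 1`.
      have h3 : s * s + n = (n % s) * (s + 1) + (s + n / s - n % s) * s := by
        zify [h2.trans (Nat.le_add_right s (n / s))]
        have h1' : (s : ℤ) * (n / s : ℕ) + (n % s : ℕ) = n := by exact_mod_cast h1
        push_cast at h1'
        linear_combination -h1'
      rw [h3]; exact hmem _ _
  exact ⟨s * s, by simpa using hall 0, hall⟩

end

theorem lemma3p7 {k : Type*} [Field k] [IsAlgClosed k]
    (f : MvPowerSeries (Fin 2) k) (hf : Irreducible f) :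
    IsLeast (PlaneBranch.conductorSet f) (PlaneBranch.conductor f) ∧
      Set.encard
        (((fun s : ℕ => (s : ℤ)) '' PlaneBranch.valueSemigroup f) \
          ((fun s : ℕ => (s : ℤ) + (PlaneBranch.conductor f : ℤ) - 1) ''
            PlaneBranch.valueSemigroup f)) =
        (PlaneBranch.conductor f : ℕ∞) := by
  have hleast : IsLeast (PlaneBranch.conductorSet f) (PlaneBranch.conductor f) :=
    ⟨Nat.sInf_mem (conductorSet_nonempty hf), fun _ h => Nat.sInf_le h⟩
  exact ⟨hleast, encard_sdiff_translate_conductor (zero_mem_valueSemigroup f) hleast⟩
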